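/- Let $G=(V,E)$ be a locally finite graph and let $\ell:E\to\mathbb R_{>0}$ assign a length to every edge. Regard $G$ as a 1-complex in which every edge $e$ is a copy of the real interval $[0,\ell(e)]$, and for points $x,y$ of this 1-complex let $d_\ell(x,y)$ be the infimum of the lengths of the $x$–$y$ arcs in it (with $d_\ell(x,y)=\infty$ if there is no such arc). Let $|G|_\ell$ be the completion of the resulting (extended) metric space, and let the boundary $\partial^\ell G$ be the subspace of $|G|_\ell$ consisting of the points that do not belong to the 1-complex $G$. A ray is a one-way infinite path in $G$, two rays are equivalent if no finite set of vertices separates them, and the ends of $G$ are the equivalence classes of rays; the elements of an end $\omega$ are called $\omega$-rays. For an end $\omega$ let $$\partial^\ell\omega=\{x\in\partial^\ell G \mid \text{there is an } \omega\text{-ray whose sequence of vertices converges to } x \text{ in } |G|_\ell\}.$$ Theorem. If $|G|_\ell$ is compact, then $\partial^\ell\omega$ is (non-empty and) connected for every end $\omega$ of $G$. Consequently, the sets $\partial^\ell\omega$, where $\omega$ ranges over the ends of $G$, are precisely the connected components of the space $\partial^\ell G$. -/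

import Mathlib

open scoped ENNReal Topology

/-! ### The metric 1-complex of a graph with edge lengths -/

namespace LTop

variable {V : Type*} {G : SimpleGraph V}

/-- The points of the 1-complex of `G`: the vertices and, for every edge `e`, the inner points of
a copy of the real interval `[0, ℓ e]`, given by their parameter `t` with `0 < t < ℓ e`. -/
inductive OneComplex (G : SimpleGraph V) (ℓ : G.edgeSet → ℝ) : Type _
  | vertex (v : V) : OneComplex G ℓ
  | inner (e : G.edgeSet) (t : ℝ) (t_pos : 0 < t) (t_lt : t < ℓ e) : OneComplex G ℓ

/-- The endvertex of `e` at the parameter `0` of the interval `[0, ℓ e]`. -/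
noncomputable def tail (e : G.edgeSet) : V := (Quot.out (e : Sym2 V)).1

/-- The endvertex of `e` at the parameter `ℓ e` of the interval `[0, ℓ e]`. -/
noncomputable def head (e : G.edgeSet) : V := (Quot.out (e : Sym2 V)).2

/-- The length of a walk: the sum of the lengths of its edges. -/
noncomputable def walkLength (ℓ : G.edgeSet → ℝ) {u v : V} (p : G.Walk u v) : ℝ≥0∞ :=
  (p.darts.map fun d => ENNReal.ofReal (ℓ ⟨d.edge, d.edge_mem⟩)).sum

/-- The distance of two vertices: the infimum of the lengths of the `u`-`v` paths
(`∞` if there are none). -/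
noncomputable def vertexDist (ℓ : G.edgeSet → ℝ) (u v : V) : ℝ≥0∞ :=
  ⨅ p : G.Path u v, walkLength ℓ (p : G.Walk u v)

open scoped Classical in
/-- The length of the half-edge joining the point `x` to the vertex `v`: it is `0` if `x = v`, and
it is `∞` if there is no such half-edge, that is, if `x` is another vertex or an inner point of an
edge that is not incident with `v`. -/
noncomputable def halfEdgeLength {ℓ : G.edgeSet → ℝ} : OneComplex G ℓ → V → ℝ≥0∞
  | .vertex u, v => if v = u then 0 else ⊤
  | .inner e t _ _, v =>
      if v = tail e then ENNReal.ofReal t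
      else if v = head e then ENNReal.ofReal (ℓ e - t)
      else ⊤

open scoped Classical in
/-- The length of the segment between two inner points of the same edge, `∞` otherwise. -/
noncomputable def segmentLength {ℓ : G.edgeSet → ℝ} : OneComplex G ℓ → OneComplex G ℓ → ℝ≥0∞
  | .inner e t _ _, .inner f s _ _ => if e = f then ENNReal.ofReal |t - s| else ⊤
  | _, _ => ⊤

/-- The distance `d_ℓ(x, y)`: the infimum of the lengths of the `x`-`y` arcs in the 1-complex.
Such an arc either stays inside one edge, or it consists of a half-edge from `x` to a vertex `u`
(trivial if `x = u`), a `u`-`v` path in the graph, and a half-edge from a vertex `v` to `y`.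
Some of the concatenations considered here are not injective, but these contain an `x`-`y` arc
that is at most as long, so they do not affect the infimum. -/
noncomputable def arcDist {ℓ : G.edgeSet → ℝ} (x y : OneComplex G ℓ) : ℝ≥0∞ :=
  min (segmentLength x y)
    (⨅ (u : V) (v : V), halfEdgeLength x u + vertexDist ℓ u v + halfEdgeLength y v)

section facts

variable {ℓ : G.edgeSet → ℝ}

theorem walkLength_append {u v w : V} (p : G.Walk u v) (q : G.Walk v w) :
    walkLength ℓ (p.append q) = walkLength ℓ p + walkLength ℓ q := by
  simp [walkLength, SimpleGraph.Walk.darts_append]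

theorem walkLength_reverse {u v : V} (p : G.Walk u v) :
    walkLength ℓ p.reverse = walkLength ℓ p := by
  simp only [walkLength, SimpleGraph.Walk.darts_reverse, List.map_reverse, List.map_map,
    List.sum_reverse]
  congr 1
  apply List.map_congr_left
  intro d _
  simp [Function.comp]

theorem vertexDist_le {u v : V} (p : G.Walk u v) : vertexDist ℓ u v ≤ walkLength ℓ p := by
  classical
  refine (iInf_le _ p.toPath).trans ?_
  exact List.Sublist.sum_le_sum ((p.darts_bypass_sublist_darts).map _) (fun _ _ => zero_le)

theorem vertexDist_self (u : V) : vertexDist ℓ u u = 0 :=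
  le_antisymm ((vertexDist_le SimpleGraph.Walk.nil).trans (by simp [walkLength])) zero_le

theorem vertexDist_comm (u v : V) : vertexDist ℓ u v = vertexDist ℓ v u := by
  have h : ∀ a b : V, vertexDist ℓ a b ≤ vertexDist ℓ b a := fun a b =>
    le_iInf fun p => (vertexDist_le p.1.reverse).trans (walkLength_reverse _).le
  exact le_antisymm (h _ _) (h _ _)

theorem vertexDist_triangle (u v w : V) :
    vertexDist ℓ u w ≤ vertexDist ℓ u v + vertexDist ℓ v w := by
  rw [vertexDist, vertexDist, vertexDist, ENNReal.iInf_add]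
  refine le_iInf fun p => ?_
  rw [ENNReal.add_iInf]
  refine le_iInf fun q => ?_
  exact (vertexDist_le (p.1.append q.1)).trans (walkLength_append _ _).le

theorem segmentLength_comm (x y : OneComplex G ℓ) : segmentLength x y = segmentLength y x := by
  cases x <;> cases y <;> simp only [segmentLength]
  rename_i e t _ _ f s _ _
  rw [abs_sub_comm]
  by_cases h : e = f
  · rw [if_pos h, if_pos h.symm]
  · rw [if_neg h, if_neg (Ne.symm h)]

theorem arcDist_comm (x y : OneComplex G ℓ) : arcDist x y = arcDist y x := by
  unfold arcDist
  rw [segmentLength_comm, iInf_comm]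
  congr 1
  refine iInf_congr fun u => iInf_congr fun v => ?_
  rw [vertexDist_comm]
  ring

theorem arcDist_self (x : OneComplex G ℓ) : arcDist x x = 0 := by
  refine le_antisymm ?_ zero_le
  cases x with
  | vertex v =>
    refine (min_le_right _ _).trans ((iInf₂_le v v).trans ?_)
    simp [halfEdgeLength, vertexDist_self]
  | inner e t h0 h1 =>
    refine (min_le_left _ _).trans ?_
    simp [segmentLength]

theorem segmentLength_triangle (x y z : OneComplex G ℓ) :
    segmentLength x z ≤ segmentLength x y + segmentLength y z := by
  cases x <;> cases y <;> cases z <;> simp only [segmentLength, top_add, add_top, le_top]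
  split_ifs <;> simp_all
  rw [← ENNReal.ofReal_add (abs_nonneg _) (abs_nonneg _)]
  exact ENNReal.ofReal_le_ofReal (abs_sub_le _ _ _)

theorem halfEdgeLength_le (x y : OneComplex G ℓ) (u : V) :
    halfEdgeLength x u ≤ segmentLength x y + halfEdgeLength y u := by
  cases x <;> cases y <;> simp only [segmentLength, top_add, le_top]
  rename_i e t ht0 ht1 f s hs0 hs1
  by_cases hef : e = f
  · subst hef
    have h1 := neg_abs_le (t - s)
    have h2 := le_abs_self (t - s)
    simp only [if_true, halfEdgeLength]
    split_ifs
    · rw [← ENNReal.ofReal_add (abs_nonneg _) hs0.le]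
      exact ENNReal.ofReal_le_ofReal (by linarith)
    · rw [← ENNReal.ofReal_add (abs_nonneg _) (by linarith)]
      exact ENNReal.ofReal_le_ofReal (by linarith)
    · simp
  · simp [hef]

theorem vertexDist_tail_head (e : G.edgeSet) :
    vertexDist ℓ (tail e) (head e) ≤ ENNReal.ofReal (ℓ e) := by
  have he : s(tail e, head e) = (e : Sym2 V) := Quot.out_eq (e : Sym2 V)
  have ha : G.Adj (tail e) (head e) := by
    rw [← SimpleGraph.mem_edgeSet, he]
    exact e.2
  refine (vertexDist_le ha.toWalk).trans ?_
  simp [walkLength, SimpleGraph.Dart.edge, he]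

theorem vertexDist_le_halfEdgeLength (x : OneComplex G ℓ) (u v : V) :
    vertexDist ℓ u v ≤ halfEdgeLength x u + halfEdgeLength x v := by
  by_cases huv : u = v
  · subst huv
    simp [vertexDist_self]
  cases x with
  | vertex w =>
    simp only [halfEdgeLength]
    split_ifs <;> simp_all
  | inner e t h0 h1 =>
    have h := vertexDist_tail_head (ℓ := ℓ) e
    have hs : ENNReal.ofReal (ℓ e) = ENNReal.ofReal t + ENNReal.ofReal (ℓ e - t) := by
      rw [← ENNReal.ofReal_add h0.le (by linarith)]
      congr 1
      ring
    rw [hs] at h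
    simp only [halfEdgeLength]
    by_cases a1 : u = tail e <;> by_cases a2 : v = tail e
    · exact absurd (a1.trans a2.symm) huv
    · by_cases a3 : v = head e
      · subst a1 a3
        simpa [a2] using h
      · simp [a2, a3]
    · by_cases a3 : u = head e
      · subst a2 a3
        rw [vertexDist_comm, add_comm]
        simpa [a1] using h
      · simp [a1, a3]
    · by_cases a3 : u = head e
      · by_cases a4 : v = head e
        · exact absurd (a3.trans a4.symm) huv
        · simp [a2, a4]
      · simp [a1, a3]

theorem arcDist_triangle (x y z : OneComplex G ℓ) :
    arcDist x z ≤ arcDist x y + arcDist y z := by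
  have key : ∀ a b : OneComplex G ℓ, ∀ u v : V,
      arcDist a b ≤ halfEdgeLength a u + vertexDist ℓ u v + halfEdgeLength b v := fun a b u v =>
    (min_le_right _ _).trans ((iInf_le _ u).trans (iInf_le _ v))
  have hxy : arcDist x y = min (segmentLength x y) (⨅ (u : V) (v : V),
    halfEdgeLength x u + vertexDist ℓ u v + halfEdgeLength y v) := rfl
  have hyz : arcDist y z = min (segmentLength y z) (⨅ (u : V) (v : V),
    halfEdgeLength y u + vertexDist ℓ u v + halfEdgeLength z v) := rfl
  rw [hxy, hyz, min_add, add_min, add_min]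
  refine le_min (le_min ?_ ?_) (le_min ?_ ?_)
  · exact (min_le_left _ _).trans (segmentLength_triangle x y z)
  · simp only [ENNReal.add_iInf]
    refine le_iInf fun u => le_iInf fun v => (key x z u v).trans ?_
    simp only [← add_assoc]
    gcongr
    exact halfEdgeLength_le x y u
  · simp only [ENNReal.iInf_add]
    refine le_iInf fun u => le_iInf fun v => (key x z u v).trans ?_
    rw [add_assoc _ (halfEdgeLength y v)]
    gcongr
    rw [segmentLength_comm, add_comm]
    exact halfEdgeLength_le z y v
  · simp only [ENNReal.iInf_add]
    refine le_iInf fun u => le_iInf fun v => ?_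
    simp only [ENNReal.add_iInf]
    refine le_iInf fun u' => le_iInf fun v' => (key x z u v').trans ?_
    calc halfEdgeLength x u + vertexDist ℓ u v' + halfEdgeLength z v'
        ≤ halfEdgeLength x u + (vertexDist ℓ u v + ((halfEdgeLength y v + halfEdgeLength y u')
            + vertexDist ℓ u' v')) + halfEdgeLength z v' := by
          gcongr
          refine (vertexDist_triangle u v v').trans ?_
          gcongr
          refine (vertexDist_triangle v u' v').trans ?_
          gcongr
          exact vertexDist_le_halfEdgeLength y v u'
      _ = _ := by ring

end facts

/-- The 1-complex with the distance `d_ℓ`. Two points in different components of the graph have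
distance `∞`, and points at distance `0` are not identified yet. -/
noncomputable instance (ℓ : G.edgeSet → ℝ) : PseudoEMetricSpace (OneComplex G ℓ) where
  edist := arcDist
  edist_self := arcDist_self
  edist_comm := arcDist_comm
  edist_triangle := arcDist_triangle

/-- The space `|G|_ℓ`: the (Hausdorff) completion of the 1-complex with respect to `d_ℓ`. It
identifies the points at distance `0` from each other. -/
abbrev Completion (G : SimpleGraph V) (ℓ : G.edgeSet → ℝ) : Type _ :=
  UniformSpace.Completion (OneComplex G ℓ)

/-- The boundary `∂^ℓ G`: the points of `|G|_ℓ` that are not images of points of the 1-complex. -/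
def boundary (G : SimpleGraph V) (ℓ : G.edgeSet → ℝ) : Set (Completion G ℓ) :=
  (Set.range fun x : OneComplex G ℓ => (x : Completion G ℓ))ᶜ

/-! ### Rays and ends -/

/-- A ray: a one-way infinite path. -/
structure Ray (G : SimpleGraph V) where
  vert : ℕ → V
  adj : ∀ n, G.Adj (vert n) (vert (n + 1))
  injective : Function.Injective vert

/-- The vertex set `S` separates `A` from `B` in `G`: every walk from `A` to `B` meets `S`. -/
def Separates (G : SimpleGraph V) (S A B : Set V) : Prop :=
  ∀ a ∈ A, ∀ b ∈ B, ∀ p : G.Walk a b, ∃ w ∈ p.support, w ∈ S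

/-- Two rays are equivalent if no finite set of vertices separates them. -/
def Ray.Equivalent (R L : Ray G) : Prop :=
  ¬ ∃ S : Set V, S.Finite ∧ Separates G S (Set.range R.vert) (Set.range L.vert)

theorem Ray.equivalent_iff (R L : Ray G) : R.Equivalent L ↔ ∀ S : Set V, S.Finite →
    ∃ m n, ∃ p : G.Walk (R.vert m) (L.vert n), ∀ w ∈ p.support, w ∉ S := by
  simp only [Ray.Equivalent, Separates]
  push Not
  simp only [Set.exists_range_iff]

theorem Ray.exists_walk_of_le (R : Ray G) (S : Set V) (N : ℕ) (h : ∀ k, N ≤ k → R.vert k ∉ S)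
    (m n : ℕ) (hm : N ≤ m) (hmn : m ≤ n) :
    ∃ p : G.Walk (R.vert m) (R.vert n), ∀ w ∈ p.support, w ∉ S := by
  induction n, hmn using Nat.le_induction with
  | base => exact ⟨.nil, by simpa using h m hm⟩
  | succ n hmn ih =>
    obtain ⟨p, hp⟩ := ih
    refine ⟨p.concat (R.adj n), fun w hw => ?_⟩
    rw [SimpleGraph.Walk.support_concat] at hw
    rcases (by simpa using hw : w ∈ p.support ∨ w = R.vert (n + 1)) with hw | rfl
    · exact hp w hw
    · exact h _ (by omega)

theorem Ray.equivalent_symm {R L : Ray G} (h : R.Equivalent L) : L.Equivalent R := by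
  rw [Ray.equivalent_iff] at h ⊢
  intro S hS
  obtain ⟨m, n, p, hp⟩ := h S hS
  exact ⟨n, m, p.reverse, by simpa using hp⟩

theorem Ray.exists_forall_notMem (R : Ray G) (S : Set V) (hS : S.Finite) :
    ∃ N, ∀ k, N ≤ k → R.vert k ∉ S := by
  obtain ⟨N, hN⟩ := (hS.preimage R.injective.injOn).bddAbove
  exact ⟨N + 1, fun k hk hmem => by have := hN hmem; omega⟩

theorem Ray.equivalent_refl (R : Ray G) : R.Equivalent R := by
  rw [Ray.equivalent_iff]
  intro S hS
  obtain ⟨N, hN⟩ := R.exists_forall_notMem S hS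
  exact ⟨N, N, R.exists_walk_of_le S N hN N N le_rfl le_rfl⟩

theorem Ray.equivalent_trans {R L T : Ray G} (h : R.Equivalent L) (h' : L.Equivalent T) :
    R.Equivalent T := by
  rw [Ray.equivalent_iff] at h h' ⊢
  intro S hS
  obtain ⟨N, hN⟩ := L.exists_forall_notMem S hS
  have hS' : (S ∪ L.vert '' Set.Iio N).Finite := hS.union ((Set.finite_Iio N).image _)
  obtain ⟨m, n, p, hp⟩ := h _ hS'
  obtain ⟨n', k, q, hq⟩ := h' _ hS'
  have hn : N ≤ n := by
    by_contra hlt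
    exact hp _ p.end_mem_support (Or.inr ⟨n, not_le.1 hlt, rfl⟩)
  have hn' : N ≤ n' := by
    by_contra hlt
    exact hq _ q.start_mem_support (Or.inr ⟨n', not_le.1 hlt, rfl⟩)
  obtain ⟨r, hr⟩ : ∃ r : G.Walk (L.vert n) (L.vert n'), ∀ w ∈ r.support, w ∉ S := by
    rcases le_total n n' with hle | hle
    · exact L.exists_walk_of_le S N hN n n' hn hle
    · obtain ⟨r, hr⟩ := L.exists_walk_of_le S N hN n' n hn' hle
      exact ⟨r.reverse, by simpa using hr⟩
  refine ⟨m, k, (p.append r).append q, fun w hw => ?_⟩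
  rw [SimpleGraph.Walk.mem_support_append_iff, SimpleGraph.Walk.mem_support_append_iff] at hw
  rcases hw with (hw | hw) | hw
  · exact fun hS => hp w hw (Or.inl hS)
  · exact hr w hw
  · exact fun hS => hq w hw (Or.inl hS)

/-- Equivalence of rays. -/
def raySetoid (G : SimpleGraph V) : Setoid (Ray G) where
  r := Ray.Equivalent
  iseqv := ⟨Ray.equivalent_refl, Ray.equivalent_symm, Ray.equivalent_trans⟩

/-- The ends of `G`: the equivalence classes of rays. -/
def Ends (G : SimpleGraph V) : Type _ := Quotient (raySetoid G)

/-- `R` is an `ω`-ray: it belongs to the equivalence class `ω`. -/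
def Ray.BelongsTo (R : Ray G) (ω : Ends G) : Prop := Quotient.mk (raySetoid G) R = ω

/-- The ray `R` converges to the point `x` of `|G|_ℓ`. -/
def Ray.ConvergesTo (R : Ray G) (ℓ : G.edgeSet → ℝ) (x : Completion G ℓ) : Prop :=
  Filter.Tendsto (fun n => ((OneComplex.vertex (R.vert n) : OneComplex G ℓ) : Completion G ℓ))
    Filter.atTop (𝓝 x)

/-- The set `∂^ℓ ω` of the boundary points that are limits of `ω`-rays. -/
def endBoundary (ℓ : G.edgeSet → ℝ) (ω : Ends G) : Set (Completion G ℓ) :=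
  {x | x ∈ boundary G ℓ ∧ ∃ R : Ray G, R.BelongsTo ω ∧ R.ConvergesTo ℓ x}

end LTop

/-!
For an end `ω` and a finite vertex set `S`, let `C(S, ω)` be the component of `G - S` that contains
tails of all `ω`-rays. It spans a connected subcomplex of the 1-complex, and `∂^ℓ ω` is the
intersection of the closures of these subcomplexes in `|G|_ℓ`. When `|G|_ℓ` is compact, this is a
directed intersection of continua, hence a continuum.

Conversely, a boundary point `x` has, for every finite `S`, a neighbourhood in which any two
vertices are joined by a short walk, which stays near `x` and so avoids `S`. Hence the boundary
points in the closure of `C(S, ω)` form a relatively clopen subset of `∂^ℓ G`, and a connected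
subset of `∂^ℓ G` cannot meet two of the sets `∂^ℓ ω`. The same walks, followed through a shrinking
sequence of neighbourhoods of `x`, sweep out an infinite connected vertex set converging to `x`, in
which Kőnig's lemma finds a ray.
-/

namespace LTop

open Filter Set UniformSpace

section Topology

theorem isConnected_iInter_of_directed {X ι : Type*} [TopologicalSpace X] [T2Space X] [Nonempty ι]
    {K : ι → Set X} (hdir : Directed (· ⊇ ·) K) (hconn : ∀ i, IsConnected (K i))
    (hcomp : ∀ i, IsCompact (K i)) : IsConnected (⋂ i, K i) := by
  have hclosed : IsClosed (⋂ i, K i) := isClosed_iInter fun i => (hcomp i).isClosed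
  have hcompact : IsCompact (⋂ i, K i) :=
    (hcomp (Classical.arbitrary ι)).of_isClosed_subset hclosed (iInter_subset _ _)
  refine ⟨IsCompact.nonempty_iInter_of_directed_nonempty_isCompact_isClosed K hdir
    (fun i => (hconn i).nonempty) hcomp fun i => (hcomp i).isClosed, ?_⟩
  rw [isPreconnected_iff_subset_of_fully_disjoint_closed hclosed]
  intro A B hA hB hcover hdisj
  obtain ⟨U, V, hU, hV, hAU, hBV, hUV⟩ := SeparatedNhds.of_isCompact_isCompact
    (hcompact.inter_right hA) (hcompact.inter_right hB)
    (hdisj.mono inter_subset_right inter_subset_right)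
  obtain ⟨i, hi⟩ : ∃ i, K i ⊆ U ∪ V :=
    exists_subset_nhds_of_isCompact hdir hcomp fun x hx => (hU.union hV).mem_nhds <|
      (hcover hx).imp (fun h => hAU ⟨hx, h⟩) fun h => hBV ⟨hx, h⟩
  refine ((hconn i).isPreconnected.subset_or_subset hU hV hUV hi).imp (fun h x hx => ?_)
    fun h x hx => ?_
  · exact (hcover hx).resolve_right fun hxB =>
      hUV.notMem_of_mem_left (h (mem_iInter.1 hx i)) (hBV ⟨hx, hxB⟩)
  · exact (hcover hx).resolve_left fun hxA =>
      hUV.notMem_of_mem_right (h (mem_iInter.1 hx i)) (hAU ⟨hx, hxA⟩)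

theorem isCountablyGenerated_uniformity_completion (α : Type*) [UniformSpace α]
    [(uniformity α).IsCountablyGenerated] :
    (uniformity (UniformSpace.Completion α)).IsCountablyGenerated := by
  obtain ⟨s, hs⟩ := (uniformity α).exists_antitone_basis
  have : (uniformity (CauchyFilter α)).IsCountablyGenerated :=
    HasCountableBasis.isCountablyGenerated
      ⟨CauchyFilter.basis_uniformity hs.toHasBasis, to_countable _⟩
  change (uniformity (SeparationQuotient (CauchyFilter α))).IsCountablyGenerated
  rw [SeparationQuotient.uniformity_eq]
  infer_instance

theorem exists_mem_nhds_subset_eball_subset {α : Type*} [PseudoEMetricSpace α]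
    {x : UniformSpace.Completion α} {U : Set (UniformSpace.Completion α)} (hU : U ∈ 𝓝 x) :
    ∃ W ∈ 𝓝 x, ∃ ε, ∀ a : α, (a : UniformSpace.Completion α) ∈ W →
      (↑) ⁻¹' W ⊆ Metric.eball a ε ∧ Metric.eball a ε ⊆ (↑) ⁻¹' U := by
  obtain ⟨T, hT, hTU⟩ := UniformSpace.mem_nhds_iff.1 hU
  obtain ⟨D, hD, hDT⟩ := comp_mem_uniformity_sets hT
  obtain ⟨ε, hε, hεD⟩ := mem_uniformity_edist.1
    (UniformSpace.Completion.uniformContinuous_coe α hD)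
  have hball : {p : α × α | edist p.1 p.2 < ε} ∈ uniformity α := edist_mem_uniformity hε
  rw [← UniformSpace.Completion.comap_coe_eq_uniformity] at hball
  obtain ⟨E, hE, hEε⟩ := hball
  obtain ⟨W, hW, hWE⟩ :=
    mem_prod_same_iff.1 (nhds_prod_eq.symm.trans_le (nhds_le_uniformity x) hE)
  refine ⟨W ∩ ball x D, inter_mem hW (ball_mem_nhds x hD), ε,
    fun a ha => ⟨fun b hb => ?_, fun b hb => ?_⟩⟩
  · have hba : (b, a) ∈ Prod.map (↑) (↑) ⁻¹' E := hWE (mk_mem_prod hb.1 ha.1)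
    exact hEε hba
  · exact hTU (hDT ⟨_, ha.2, hεD (Metric.mem_eball'.1 hb)⟩)

end Topology

variable {V : Type*} {G : SimpleGraph V}

section Konig

/-- The vertices `w` such that some geodesic from `r` to `w` passes through `v`. -/
def geodesicShadow (G : SimpleGraph V) (r v : V) : Set V :=
  {w | G.dist r w = G.dist r v + G.dist v w}

theorem geodesicShadow_subset_insert_iUnion (hG : G.Connected) (r v : V) :
    geodesicShadow G r v ⊆ insert v
      (⋃ u ∈ {u ∈ G.neighborSet v | G.dist r u = G.dist r v + 1}, geodesicShadow G r u) := by
  intro w hw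
  obtain ⟨p, hp⟩ := hG.exists_walk_length_eq_dist v w
  cases p with
  | nil => exact mem_insert _ _
  | @cons _ u _ hvu p =>
    have hvw : G.dist r w = G.dist r v + G.dist v w := hw
    have hlen : p.length + 1 = G.dist v w := hp
    have huw : G.dist u w ≤ p.length := G.dist_le p
    have hru : G.dist r u ≤ G.dist r v + G.dist v u := hG.dist_triangle
    have hrw : G.dist r w ≤ G.dist r u + G.dist u w := hG.dist_triangle
    rw [SimpleGraph.dist_eq_one_iff_adj.2 hvu] at hru
    exact mem_insert_of_mem _ (mem_biUnion (x := u) ⟨hvu, by omega⟩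
      (show G.dist r w = G.dist r u + G.dist u w by omega))

theorem exists_adj_infinite_geodesicShadow [G.LocallyFinite] (hG : G.Connected) {r v : V}
    (hv : (geodesicShadow G r v).Infinite) :
    ∃ u, G.Adj v u ∧ G.dist r u = G.dist r v + 1 ∧ (geodesicShadow G r u).Infinite := by
  by_contra! hfin
  refine hv ((Finite.insert v (Finite.biUnion ?_ fun u hu => ?_)).subset
    (geodesicShadow_subset_insert_iUnion hG r v))
  · exact (toFinite (G.neighborSet v)).subset (sep_subset _ _)
  · exact hfin u hu.1 hu.2

/-- Kőnig's lemma: the ray descends along geodesics from a root through vertices whose shadow is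
infinite. -/
theorem nonempty_ray [G.LocallyFinite] [Infinite V] (hG : G.Connected) : Nonempty (Ray G) := by
  obtain ⟨r⟩ := hG.nonempty
  have hr : (geodesicShadow G r r).Infinite := by
    simpa [geodesicShadow] using infinite_univ
  choose next hadj hdist hinf using
    fun v : {v // (geodesicShadow G r v).Infinite} => exists_adj_infinite_geodesicShadow hG v.2
  let vert : ℕ → {v // (geodesicShadow G r v).Infinite} :=
    Nat.rec ⟨r, hr⟩ fun _ v => ⟨next v, hinf v⟩
  have hvert : ∀ n, G.dist r (vert n).1 = n := by
    intro n
    induction n with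
    | zero => exact G.dist_self
    | succ n ih => exact (hdist (vert n)).trans (by rw [ih])
  refine ⟨⟨fun n => (vert n).1, fun n => hadj (vert n), fun m n hmn => ?_⟩⟩
  rw [← hvert m, ← hvert n]
  exact congrArg (G.dist r) hmn

theorem exists_ray_forall_mem [G.LocallyFinite] {A : Set V} (hA : A.Infinite)
    (hconn : (G.induce A).Connected) : ∃ R : Ray G, ∀ n, R.vert n ∈ A := by
  have : Infinite A := hA.to_subtype
  have : (G.induce A).LocallyFinite := fun v =>
    ((toFinite (G.neighborSet v)).preimage Subtype.val_injective.injOn).fintype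
  obtain ⟨R⟩ := nonempty_ray hconn
  exact ⟨⟨fun n => R.vert n, R.adj, Subtype.val_injective.comp R.injective⟩,
    fun n => (R.vert n).2⟩

theorem connected_induce_iUnion_support (v : ℕ → V) (p : ∀ n, G.Walk (v n) (v (n + 1))) :
    (G.induce (⋃ n, {w | w ∈ (p n).support})).Connected := by
  set A := ⋃ n, {w | w ∈ (p n).support}
  have hreach : ∀ n {a b} (ha : a ∈ (p n).support) (hb : b ∈ (p n).support),
      (G.induce A).Reachable ⟨a, mem_iUnion.2 ⟨n, ha⟩⟩ ⟨b, mem_iUnion.2 ⟨n, hb⟩⟩ :=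
    fun n a b ha hb => ((p n).connected_induce_support ⟨a, ha⟩ ⟨b, hb⟩).map
      (G.induceHomOfLE (subset_iUnion (fun n => {w | w ∈ (p n).support}) n)).toHom
  have hv : ∀ n, v n ∈ A := fun n => mem_iUnion.2 ⟨n, (p n).start_mem_support⟩
  have hroot : ∀ n, (G.induce A).Reachable ⟨v 0, hv 0⟩ ⟨v n, hv n⟩ := by
    intro n
    induction n with
    | zero => rfl
    | succ n ih => exact ih.trans (hreach n (p n).start_mem_support (p n).end_mem_support)
  refine SimpleGraph.connected_iff_exists_forall_reachable _ |>.2 ⟨⟨v 0, hv 0⟩, fun ⟨w, hw⟩ => ?_⟩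
  obtain ⟨n, hn⟩ := mem_iUnion.1 hw
  exact (hroot n).trans (hreach n (p n).start_mem_support hn)

end Konig

section Component

/-- The vertices `u` and `v` are joined by a walk all of whose vertices lie in `A`. -/
def ReachableIn (G : SimpleGraph V) (A : Set V) (u v : V) : Prop :=
  ∃ p : G.Walk u v, ∀ w ∈ p.support, w ∈ A

namespace ReachableIn

variable {A B : Set V} {u v w : V}

theorem symm (h : ReachableIn G A u v) : ReachableIn G A v u := by
  obtain ⟨p, hp⟩ := h
  exact ⟨p.reverse, by simpa using hp⟩

theorem trans (h : ReachableIn G A u v) (h' : ReachableIn G A v w) : ReachableIn G A u w := by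
  obtain ⟨p, hp⟩ := h
  obtain ⟨q, hq⟩ := h'
  refine ⟨p.append q, fun z hz => ?_⟩
  rw [SimpleGraph.Walk.mem_support_append_iff] at hz
  exact hz.elim (hp z) (hq z)

theorem mono (hAB : A ⊆ B) (h : ReachableIn G A u v) : ReachableIn G B u v := by
  obtain ⟨p, hp⟩ := h
  exact ⟨p, fun w hw => hAB (hp w hw)⟩

theorem left_mem (h : ReachableIn G A u v) : u ∈ A := by
  obtain ⟨p, hp⟩ := h
  exact hp u p.start_mem_support

theorem right_mem (h : ReachableIn G A u v) : v ∈ A := h.symm.left_mem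

end ReachableIn

namespace Ray

variable {R L : Ray G} {S T : Set V} {u v : V}

theorem exists_forall_ge_reachableIn (R : Ray G) (hS : S.Finite) :
    ∃ N, ∀ m ≥ N, ∀ n ≥ N, ReachableIn G Sᶜ (R.vert m) (R.vert n) := by
  obtain ⟨N, hN⟩ := R.exists_forall_notMem S hS
  refine ⟨N, fun m hm n hn => ?_⟩
  rcases le_total m n with hmn | hnm
  · exact R.exists_walk_of_le S N hN m n hm hmn
  · exact ReachableIn.symm (R.exists_walk_of_le S N hN n m hn hnm)

/-- The vertex set of the component of `G - S` in which the ray `R` has a tail, for finite `S`. -/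
def component (R : Ray G) (S : Set V) : Set V :=
  {v | ∀ᶠ n in atTop, ReachableIn G Sᶜ (R.vert n) v}

theorem component_anti (R : Ray G) (hST : S ⊆ T) : R.component T ⊆ R.component S := fun _ hv =>
  hv.mono fun _ => ReachableIn.mono (compl_subset_compl.2 hST)

theorem disjoint_component (R : Ray G) (S : Set V) : Disjoint (R.component S) S :=
  disjoint_left.2 fun _ hv => hv.exists.choose_spec.right_mem

theorem reachableIn_of_mem_component (hu : u ∈ R.component S) (hv : v ∈ R.component S) :
    ReachableIn G Sᶜ u v := by
  obtain ⟨n, hnu, hnv⟩ := (hu.and hv).exists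
  exact hnu.symm.trans hnv

theorem mem_component_of_reachableIn (hu : u ∈ R.component S) (h : ReachableIn G Sᶜ u v) :
    v ∈ R.component S :=
  hu.mono fun _ hn => hn.trans h

theorem Equivalent.eventually_vert_mem_component (h : R.Equivalent L) (hS : S.Finite) :
    ∀ᶠ n in atTop, L.vert n ∈ R.component S := by
  obtain ⟨M, hM⟩ := R.exists_forall_ge_reachableIn hS
  obtain ⟨N, hN⟩ := L.exists_forall_ge_reachableIn hS
  obtain ⟨m, n, hmn⟩ : ∃ m n, ReachableIn G (S ∪ (R.vert '' Iio M ∪ L.vert '' Iio N))ᶜ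
      (R.vert m) (L.vert n) :=
    (equivalent_iff R L).1 h _
      (hS.union (((finite_Iio M).image _).union ((finite_Iio N).image _)))
  have hm : M ≤ m := not_lt.1 fun hlt => hmn.left_mem (.inr (.inl ⟨m, hlt, rfl⟩))
  have hn : N ≤ n := not_lt.1 fun hlt => hmn.right_mem (.inr (.inr ⟨n, hlt, rfl⟩))
  filter_upwards [eventually_ge_atTop N] with k hk
  filter_upwards [eventually_ge_atTop M] with j hj
  exact ((hM j hj m hm).trans (hmn.mono (compl_subset_compl.2 subset_union_left))).trans
    (hN n hn k hk)

theorem connected_induce_component (R : Ray G) (hS : S.Finite) :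
    (G.induce (R.component S)).Connected := by
  classical
  obtain ⟨n, hn⟩ := (R.equivalent_refl.eventually_vert_mem_component hS).exists
  have : Nonempty (R.component S) := ⟨⟨_, hn⟩⟩
  refine ⟨fun ⟨u, hu⟩ ⟨v, hv⟩ => ?_⟩
  obtain ⟨p, hp⟩ := reachableIn_of_mem_component hu hv
  refine ⟨p.induce _ fun w hw => mem_component_of_reachableIn hu ?_⟩
  exact ⟨p.takeUntil w hw, fun z hz => hp z (p.support_takeUntil_subset_support hw hz)⟩

end Ray

end Component

variable {ℓ : G.edgeSet → ℝ}

section Cells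

/-- The vertices of the smallest closed cell (a vertex or a closed edge) that contains `x`. -/
def cellVertices (x : OneComplex G ℓ) : Set V :=
  {v | halfEdgeLength x v ≠ ⊤}

@[simp]
theorem cellVertices_vertex (v : V) : cellVertices (.vertex v : OneComplex G ℓ) = {v} := by
  ext w
  simp [cellVertices, halfEdgeLength]

@[simp]
theorem cellVertices_inner (e : G.edgeSet) (t : ℝ) (h0 : 0 < t) (h1 : t < ℓ e) :
    cellVertices (.inner e t h0 h1) = {tail e, head e} := by
  ext w
  simp only [cellVertices, halfEdgeLength, mem_ofPred_eq]
  split_ifs with ht hh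
  · simp [ht]
  · simp [hh]
  · simp [ht, hh]

theorem finite_cellVertices (x : OneComplex G ℓ) : (cellVertices x).Finite := by
  cases x with
  | vertex v => exact cellVertices_vertex v ▸ finite_singleton v
  | inner e t h0 h1 => exact cellVertices_inner e t h0 h1 ▸ toFinite _

theorem segmentLength_eq_top_of_disjoint {x y : OneComplex G ℓ}
    (h : Disjoint (cellVertices x) (cellVertices y)) : segmentLength x y = ⊤ := by
  cases x with
  | vertex => rfl
  | inner e t =>
    cases y with
    | vertex => rfl
    | inner f s =>
      refine if_neg fun hef => ?_
      subst hef
      exact h.notMem_of_mem_left (a := tail e) (by simp) (by simp)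

theorem le_edist_of_segmentLength_eq_top {x y : OneComplex G ℓ} {δ : ℝ≥0∞}
    (hxy : segmentLength x y = ⊤)
    (h : ∀ u ∈ cellVertices x, ∀ v ∈ cellVertices y, δ ≤ halfEdgeLength x u + vertexDist ℓ u v) :
    δ ≤ edist x y := by
  refine le_min (hxy ▸ le_top) (le_iInf₂ fun u v => ?_)
  by_cases hu : halfEdgeLength x u = ⊤
  · simp [hu]
  by_cases hv : halfEdgeLength y v = ⊤
  · simp [hv]
  · exact (h u hu v hv).trans le_self_add

theorem edist_vertex_right_le (x : OneComplex G ℓ) (u : V) :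
    edist x (.vertex u) ≤ halfEdgeLength x u :=
  (min_le_right _ _).trans <| (iInf₂_le u u).trans <| by simp [vertexDist_self, halfEdgeLength]

theorem edist_vertex_vertex (u v : V) :
    edist (.vertex u : OneComplex G ℓ) (.vertex v) = vertexDist ℓ u v := by
  refine le_antisymm ((min_le_right _ _).trans <| (iInf₂_le u v).trans ?_)
    (le_edist_of_segmentLength_eq_top rfl ?_)
  · simp [halfEdgeLength]
  · simp

theorem exists_mem_cellVertices_edist_lt {x y : OneComplex G ℓ} {ε : ℝ≥0∞}
    (hxy : segmentLength x y = ⊤) (h : edist x y < ε) :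
    ∃ u ∈ cellVertices x, edist x (.vertex u) < ε := by
  by_contra! hfar
  exact h.not_ge <| le_edist_of_segmentLength_eq_top hxy fun u hu v _ =>
    (hfar u hu).trans ((edist_vertex_right_le x u).trans le_self_add)

theorem vertexDist_le_of_mem_support {u v w : V} (p : G.Walk u v) (hw : w ∈ p.support) :
    vertexDist ℓ u w ≤ walkLength ℓ p := by
  classical
  refine (vertexDist_le (p.takeUntil w hw)).trans ?_
  conv_rhs => rw [← p.take_spec hw, walkLength_append]
  exact le_self_add

theorem exists_pos_forall_ne_le_vertexDist [G.LocallyFinite] (hℓ : ∀ e, 0 < ℓ e) (v : V) :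
    ∃ δ > 0, ∀ w ≠ v, δ ≤ vertexDist ℓ v w := by
  have hshort : ∀ᶠ δ : ℝ≥0∞ in 𝓝[>] 0, ∀ w : G.neighborSet v,
      δ ≤ ENNReal.ofReal (ℓ ⟨s(v, w.1), w.2⟩) :=
    eventually_all.2 fun w => nhdsWithin_le_nhds (Iic_mem_nhds (ENNReal.ofReal_pos.2 (hℓ _)))
  obtain ⟨δ, hδ, hpos⟩ := (hshort.and self_mem_nhdsWithin).exists
  refine ⟨δ, hpos, fun w hw => le_iInf fun ⟨p, _⟩ => ?_⟩
  cases p with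
  | nil => exact absurd rfl hw
  | cons h q => exact (hδ ⟨_, h⟩).trans (by simp [walkLength, SimpleGraph.Dart.edge])

theorem ofReal_min_le_halfEdgeLength_inner (e : G.edgeSet) (t : ℝ) (h0 : 0 < t) (h1 : t < ℓ e)
    (u : V) : ENNReal.ofReal (min t (ℓ e - t)) ≤ halfEdgeLength (.inner e t h0 h1) u := by
  simp only [halfEdgeLength]
  split_ifs
  · exact ENNReal.ofReal_le_ofReal (min_le_left _ _)
  · exact ENNReal.ofReal_le_ofReal (min_le_right _ _)
  · exact le_top

theorem exists_pos_forall_disjoint_le_edist [G.LocallyFinite] (hℓ : ∀ e, 0 < ℓ e)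
    (y : OneComplex G ℓ) :
    ∃ δ > 0, ∀ z, Disjoint (cellVertices y) (cellVertices z) → δ ≤ edist y z := by
  cases y with
  | vertex v =>
    obtain ⟨δ, hδ, hfar⟩ := exists_pos_forall_ne_le_vertexDist hℓ v
    refine ⟨δ, hδ, fun z hz => le_edist_of_segmentLength_eq_top
      (segmentLength_eq_top_of_disjoint hz) fun u hu w hw => ?_⟩
    have hvw : w ≠ v := fun h => hz.notMem_of_mem_left (by simp) (h ▸ hw)
    obtain rfl : u = v := by simpa using hu
    exact (hfar w hvw).trans le_add_self
  | inner e t h0 h1 =>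
    exact ⟨_, ENNReal.ofReal_pos.2 (lt_min h0 (sub_pos.2 h1)), fun z hz =>
      le_edist_of_segmentLength_eq_top (segmentLength_eq_top_of_disjoint hz) fun u _ w _ =>
        (ofReal_min_le_halfEdgeLength_inner e t h0 h1 u).trans le_self_add⟩

end Cells

section Subcomplex

theorem mk_tail_head (e : G.edgeSet) : s(tail e, head e) = (e : Sym2 V) :=
  Quot.out_eq (e : Sym2 V)

theorem tail_ne_head (e : G.edgeSet) : tail e ≠ head e := by
  have h : s(tail e, head e) ∈ G.edgeSet := (mk_tail_head e).symm ▸ e.2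
  exact G.ne_of_adj h

/-- The parametrization of the edge `e` by the interval `[0, ℓ e]`, extended constantly. -/
noncomputable def edgePoint (ℓ : G.edgeSet → ℝ) (e : G.edgeSet) (t : ℝ) : OneComplex G ℓ :=
  if h0 : 0 < t then
    if h1 : t < ℓ e then .inner e t h0 h1 else .vertex (head e)
  else .vertex (tail e)

@[simp]
theorem edgePoint_zero (e : G.edgeSet) : edgePoint ℓ e 0 = .vertex (tail e) := by
  simp [edgePoint]

theorem edgePoint_length {e : G.edgeSet} (he : 0 < ℓ e) :
    edgePoint ℓ e (ℓ e) = .vertex (head e) := by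
  simp [edgePoint, he]

theorem edgePoint_of_lt {e : G.edgeSet} {t : ℝ} (h0 : 0 < t) (h1 : t < ℓ e) :
    edgePoint ℓ e t = .inner e t h0 h1 := by
  simp [edgePoint, h0, h1]

theorem edist_edgePoint_le {e : G.edgeSet} {s t : ℝ} (hs : 0 ≤ s) (hst : s ≤ t) (ht : t ≤ ℓ e) :
    edist (edgePoint ℓ e s) (edgePoint ℓ e t) ≤ ENNReal.ofReal (t - s) := by
  rcases hst.eq_or_lt with rfl | hst
  · simp
  rcases hs.eq_or_lt with rfl | hs <;> rcases ht.eq_or_lt with rfl | ht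
  · rw [edgePoint_zero, edgePoint_length hst, edist_vertex_vertex, sub_zero]
    exact vertexDist_tail_head e
  · rw [edgePoint_zero, edgePoint_of_lt hst ht, edist_comm]
    exact (edist_vertex_right_le _ _).trans (by simp [halfEdgeLength])
  · rw [edgePoint_of_lt hs hst, edgePoint_length (hs.trans hst)]
    exact (edist_vertex_right_le _ _).trans (by simp [halfEdgeLength, (tail_ne_head e).symm])
  · rw [edgePoint_of_lt hs (hst.trans ht), edgePoint_of_lt (hs.trans hst) ht]
    refine (min_le_left _ _).trans ?_
    rw [segmentLength, if_pos rfl, abs_sub_comm, abs_of_pos (sub_pos.2 hst)]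

theorem continuousOn_edgePoint (e : G.edgeSet) : ContinuousOn (edgePoint ℓ e) (Icc 0 (ℓ e)) := by
  refine LipschitzOnWith.continuousOn (K := 1) fun s hs t ht => ?_
  rw [ENNReal.coe_one, one_mul, edist_dist]
  rcases le_total s t with hst | hts
  · rw [dist_comm, Real.dist_eq, abs_of_nonneg (sub_nonneg.2 hst)]
    exact edist_edgePoint_le hs.1 hst ht.2
  · rw [edist_comm, Real.dist_eq, abs_of_nonneg (sub_nonneg.2 hts)]
    exact edist_edgePoint_le ht.1 hts hs.2

/-- The edge `e` together with its endvertices, as a subset of the 1-complex. -/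
def closedEdge (ℓ : G.edgeSet → ℝ) (e : G.edgeSet) : Set (OneComplex G ℓ) :=
  edgePoint ℓ e '' Icc 0 (ℓ e)

theorem isCompact_closedEdge (e : G.edgeSet) : IsCompact (closedEdge ℓ e) :=
  isCompact_Icc.image_of_continuousOn (continuousOn_edgePoint e)

theorem isPathConnected_closedEdge {e : G.edgeSet} (he : 0 ≤ ℓ e) :
    IsPathConnected (closedEdge ℓ e) :=
  ((convex_Icc 0 (ℓ e)).isPathConnected (nonempty_Icc.2 he)).image' (continuousOn_edgePoint e)

theorem vertex_tail_mem_closedEdge {e : G.edgeSet} (he : 0 ≤ ℓ e) :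
    .vertex (tail e) ∈ closedEdge ℓ e :=
  ⟨0, left_mem_Icc.2 he, edgePoint_zero e⟩

theorem vertex_head_mem_closedEdge {e : G.edgeSet} (he : 0 < ℓ e) :
    .vertex (head e) ∈ closedEdge ℓ e :=
  ⟨ℓ e, right_mem_Icc.2 he.le, edgePoint_length he⟩

theorem inner_mem_closedEdge (e : G.edgeSet) (t : ℝ) (h0 : 0 < t) (h1 : t < ℓ e) :
    .inner e t h0 h1 ∈ closedEdge ℓ e :=
  ⟨t, ⟨h0.le, h1.le⟩, edgePoint_of_lt h0 h1⟩

/-- The subcomplex of the 1-complex that is spanned by the vertex set `A`. -/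
def subcomplex (ℓ : G.edgeSet → ℝ) (A : Set V) : Set (OneComplex G ℓ) :=
  {x | cellVertices x ⊆ A}

theorem subcomplex_mono {A B : Set V} (h : A ⊆ B) : subcomplex ℓ A ⊆ subcomplex ℓ B :=
  fun _ hx => Subset.trans hx h

@[simp]
theorem vertex_mem_subcomplex {A : Set V} {v : V} : .vertex v ∈ subcomplex ℓ A ↔ v ∈ A := by
  simp [subcomplex]

theorem closedEdge_subset_subcomplex {A : Set V} {e : G.edgeSet} (ht : tail e ∈ A)
    (hh : head e ∈ A) : closedEdge ℓ e ⊆ subcomplex ℓ A := by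
  rintro _ ⟨t, -, rfl⟩
  unfold edgePoint
  split_ifs <;> simp [subcomplex, pair_subset_iff, ht, hh]

theorem isPathConnected_subcomplex (hℓ : ∀ e, 0 < ℓ e) {A : Set V}
    (hA : (G.induce A).Connected) : IsPathConnected (subcomplex ℓ A) := by
  have hadj : ∀ u v : A, (G.induce A).Adj u v →
      JoinedIn (subcomplex ℓ A) (.vertex u) (.vertex v) := by
    intro u v huv
    let e : G.edgeSet := ⟨s(u, v), huv⟩
    have hjoin : tail e ∈ A → head e ∈ A →
        JoinedIn (subcomplex ℓ A) (.vertex (tail e)) (.vertex (head e)) := fun ht hh =>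
      ((isPathConnected_closedEdge (hℓ e).le).joinedIn _ (vertex_tail_mem_closedEdge (hℓ e).le)
        _ (vertex_head_mem_closedEdge (hℓ e))).mono (closedEdge_subset_subcomplex ht hh)
    rcases Sym2.eq_iff.1 (mk_tail_head e) with ⟨ht, hh⟩ | ⟨ht, hh⟩ <;> rw [ht, hh] at hjoin
    · exact hjoin u.2 v.2
    · exact (hjoin v.2 u.2).symm
  have hvertex : ∀ u v : A, JoinedIn (subcomplex ℓ A) (.vertex u) (.vertex v) := by
    intro u v
    obtain ⟨p⟩ := hA u v
    induction p with
    | nil => exact JoinedIn.refl (vertex_mem_subcomplex.2 (Subtype.prop _))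
    | cons h _ ih => exact (hadj _ _ h).trans ih
  obtain ⟨r⟩ := hA.nonempty
  refine ⟨.vertex r, vertex_mem_subcomplex.2 r.2, fun {x} hx => ?_⟩
  cases x with
  | vertex v => exact hvertex r ⟨v, vertex_mem_subcomplex.1 hx⟩
  | inner e t h0 h1 =>
    obtain ⟨ht, hh⟩ : tail e ∈ A ∧ head e ∈ A := by simpa [subcomplex, pair_subset_iff] using hx
    exact (hvertex r ⟨_, ht⟩).trans <| ((isPathConnected_closedEdge (hℓ e).le).joinedIn _
      (vertex_tail_mem_closedEdge (hℓ e).le) _ (inner_mem_closedEdge e t h0 h1)).mono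
        (closedEdge_subset_subcomplex ht hh)

end Subcomplex

section Boundary

/-- The vertex `v` as a point of `|G|_ℓ`. -/
noncomputable def vertexPoint (ℓ : G.edgeSet → ℝ) (v : V) : Completion G ℓ :=
  ((OneComplex.vertex v : OneComplex G ℓ) : Completion G ℓ)

variable {x : Completion G ℓ} {A S : Set V}

theorem exists_coe_mem_segmentLength_eq_top (hx : x ∈ boundary G ℓ) {W : Set (Completion G ℓ)}
    (hW : W ∈ 𝓝 x) (a : OneComplex G ℓ) :
    ∃ b : OneComplex G ℓ, (b : Completion G ℓ) ∈ W ∧ segmentLength a b = ⊤ := by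
  have hdense : ∀ U ∈ 𝓝 x, ∃ b : OneComplex G ℓ, (b : Completion G ℓ) ∈ U := fun U hU => by
    obtain ⟨_, hb, b, rfl⟩ := mem_closure_iff_nhds.1 (Completion.denseRange_coe x) U hU
    exact ⟨b, hb⟩
  cases a with
  | vertex v =>
    obtain ⟨b, hb⟩ := hdense W hW
    exact ⟨b, hb, rfl⟩
  | inner e t h0 h1 =>
    have hcompact : IsCompact ((↑) '' closedEdge ℓ e : Set (Completion G ℓ)) :=
      (isCompact_closedEdge e).image (Completion.continuous_coe _)
    have hxe : x ∉ ((↑) '' closedEdge ℓ e : Set (Completion G ℓ)) :=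
      fun ⟨b, _, hb⟩ => hx ⟨b, hb⟩
    obtain ⟨b, hbW, hbe⟩ := hdense _ (inter_mem hW (hcompact.isClosed.compl_mem_nhds hxe))
    refine ⟨b, hbW, ?_⟩
    cases b with
    | vertex => rfl
    | inner f s g0 g1 =>
      refine if_neg fun hef => ?_
      subst hef
      exact hbe ⟨_, inner_mem_closedEdge e s g0 g1, rfl⟩

theorem mem_closure_image_vertexPoint_of_mem_closure_subcomplex (hx : x ∈ boundary G ℓ)
    (h : x ∈ closure ((↑) '' subcomplex ℓ A)) : x ∈ closure (vertexPoint ℓ '' A) := by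
  refine mem_closure_iff_nhds.2 fun U hU => ?_
  obtain ⟨W, hW, ε, hWε⟩ := exists_mem_nhds_subset_eball_subset hU
  obtain ⟨_, haW, a, haA, rfl⟩ := mem_closure_iff_nhds.1 h W hW
  obtain ⟨hWa, haU⟩ := hWε a haW
  -- `b` is close to `a` but not on the same edge, so the arc to `b` soon reaches a vertex.
  obtain ⟨b, hbW, hab⟩ := exists_coe_mem_segmentLength_eq_top hx hW a
  obtain ⟨u, hua, hu⟩ := exists_mem_cellVertices_edist_lt hab (Metric.mem_eball'.1 (hWa hbW))
  exact ⟨_, haU (Metric.mem_eball'.2 hu), u, haA hua, rfl⟩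

theorem mem_closure_range_vertexPoint (hx : x ∈ boundary G ℓ) :
    x ∈ closure (range (vertexPoint ℓ)) := by
  rw [← image_univ]
  refine mem_closure_image_vertexPoint_of_mem_closure_subcomplex hx ?_
  simpa [subcomplex] using (Completion.denseRange_coe : DenseRange ((↑) : OneComplex G ℓ → _)) x

theorem notMem_image_vertexPoint (hx : x ∈ boundary G ℓ) : x ∉ vertexPoint ℓ '' A :=
  fun ⟨_, _, hv⟩ => hx ⟨_, hv⟩

theorem infinite_of_mem_closure_image_vertexPoint (hx : x ∈ boundary G ℓ)
    (h : x ∈ closure (vertexPoint ℓ '' A)) : A.Infinite := by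
  intro hA
  rw [(hA.image _).isClosed.closure_eq] at h
  exact notMem_image_vertexPoint hx h

theorem exists_mem_nhds_reachableIn_preimage {U : Set (Completion G ℓ)} (hU : U ∈ 𝓝 x) :
    ∃ W ∈ 𝓝 x, ∀ u v, vertexPoint ℓ u ∈ W → vertexPoint ℓ v ∈ W →
      ReachableIn G (vertexPoint ℓ ⁻¹' U) u v := by
  obtain ⟨W, hW, ε, hWε⟩ := exists_mem_nhds_subset_eball_subset hU
  refine ⟨W, hW, fun u v hu hv => ?_⟩
  obtain ⟨hWu, huU⟩ := hWε _ hu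
  have huv := Metric.mem_eball'.1 (hWu hv)
  rw [edist_vertex_vertex] at huv
  obtain ⟨p, hp⟩ := iInf_lt_iff.1 huv
  refine ⟨p, fun w hw => huU (Metric.mem_eball'.2 ?_)⟩
  rw [edist_vertex_vertex]
  exact (vertexDist_le_of_mem_support _ hw).trans_lt hp

theorem exists_mem_nhds_reachableIn_compl (hx : x ∈ boundary G ℓ) (hS : S.Finite) :
    ∃ W ∈ 𝓝 x, ∀ u v, vertexPoint ℓ u ∈ W → vertexPoint ℓ v ∈ W → ReachableIn G Sᶜ u v := by
  have hxS : (vertexPoint ℓ '' S)ᶜ ∈ 𝓝 x :=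
    (hS.image _).isClosed.compl_mem_nhds (notMem_image_vertexPoint hx)
  obtain ⟨W, hW, hreach⟩ := exists_mem_nhds_reachableIn_preimage hxS
  have hsub : vertexPoint ℓ ⁻¹' (vertexPoint ℓ '' S)ᶜ ⊆ Sᶜ :=
    fun w hw hwS => hw (mem_image_of_mem _ hwS)
  exact ⟨W, hW, fun u v hu hv => (hreach u v hu hv).mono hsub⟩

theorem exists_hasAntitoneBasis_nhds_reachableIn (x : Completion G ℓ) :
    ∃ B : ℕ → Set (Completion G ℓ), (𝓝 x).HasAntitoneBasis B ∧ ∀ n u v,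
      vertexPoint ℓ u ∈ B (n + 1) → vertexPoint ℓ v ∈ B (n + 1) →
        ReachableIn G (vertexPoint ℓ ⁻¹' B n) u v := by
  have := isCountablyGenerated_uniformity_completion (OneComplex G ℓ)
  obtain ⟨B, hB⟩ := (𝓝 x).exists_antitone_basis
  obtain ⟨φ, -, hφ, hbasis⟩ := hB.subbasis_with_rel (r := fun m n => ∀ u v,
      vertexPoint ℓ u ∈ B n → vertexPoint ℓ v ∈ B n → ReachableIn G (vertexPoint ℓ ⁻¹' B m) u v)
    fun m => by
      obtain ⟨W, hW, hreach⟩ := exists_mem_nhds_reachableIn_preimage (hB.mem m)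
      filter_upwards [hB.eventually_subset hW] with n hn u v hu hv
      exact hreach u v (hn hu) (hn hv)
  exact ⟨B ∘ φ, hbasis, fun n => hφ n.lt_succ_self⟩

theorem exists_infinite_connected_tendsto_vertexPoint (hx : x ∈ boundary G ℓ) :
    ∃ A : Set V, A.Infinite ∧ (G.induce A).Connected ∧
      Tendsto (vertexPoint ℓ) (cofinite ⊓ 𝓟 A) (𝓝 x) := by
  obtain ⟨B, hB, hreach⟩ := exists_hasAntitoneBasis_nhds_reachableIn x
  have hvertex : ∀ n, ∃ v, vertexPoint ℓ v ∈ B (n + 1) := fun n => by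
    obtain ⟨_, hv, v, rfl⟩ :=
      mem_closure_iff_nhds.1 (mem_closure_range_vertexPoint hx) _ (hB.mem (n + 1))
    exact ⟨v, hv⟩
  choose v hv using hvertex
  choose p hp using fun n =>
    hreach n (v n) (v (n + 1)) (hv n) (hB.antitone (n + 1).le_succ (hv (n + 1)))
  have hlim : Tendsto (vertexPoint ℓ ∘ v) atTop (𝓝 x) :=
    hB.tendsto fun n => hB.antitone n.le_succ (hv n)
  refine ⟨⋃ n, {w | w ∈ (p n).support}, ?_, connected_induce_iUnion_support v p, ?_⟩
  · exact infinite_of_mem_closure_image_vertexPoint hx <| mem_closure_of_tendsto hlim <|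
      Eventually.of_forall fun n =>
        mem_image_of_mem _ (mem_iUnion.2 ⟨n, (p n).start_mem_support⟩)
  · refine hB.tendsto_right_iff.2 fun m _ => eventually_inf_principal.2 ?_
    have hfin : (⋃ n ∈ Iio m, {w | w ∈ (p n).support}).Finite :=
      (finite_Iio m).biUnion fun n _ => (p n).support.finite_toSet
    filter_upwards [hfin.compl_mem_cofinite] with w hw hwA
    obtain ⟨n, hn⟩ := mem_iUnion.1 hwA
    have hmn : m ≤ n := not_lt.1 fun hnm => hw (mem_biUnion hnm hn)
    exact hB.antitone hmn (hp n w hn)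

theorem exists_ray_convergesTo [G.LocallyFinite] (hx : x ∈ boundary G ℓ) :
    ∃ R : Ray G, R.ConvergesTo ℓ x := by
  obtain ⟨A, hA, hconn, hlim⟩ := exists_infinite_connected_tendsto_vertexPoint hx
  obtain ⟨R, hR⟩ := exists_ray_forall_mem hA hconn
  exact ⟨R, hlim.comp <| tendsto_inf.2 ⟨Nat.cofinite_eq_atTop ▸ R.injective.tendsto_cofinite,
    tendsto_principal.2 (Eventually.of_forall hR)⟩⟩

end Boundary

section EndBoundary

variable {x : Completion G ℓ} {R : Ray G} {ω : Ends G}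

theorem equivalent_of_convergesTo {L : Ray G} (hx : x ∈ boundary G ℓ) (hL : L.ConvergesTo ℓ x)
    (hR : ∀ S : Set V, S.Finite → x ∈ closure (vertexPoint ℓ '' R.component S)) :
    R.Equivalent L := by
  refine (Ray.equivalent_iff R L).2 fun S hS => ?_
  obtain ⟨W, hW, hreach⟩ := exists_mem_nhds_reachableIn_compl hx hS
  obtain ⟨_, huW, u, hu, rfl⟩ := mem_closure_iff_nhds.1 (hR S hS) W hW
  obtain ⟨m, hm⟩ := hu.exists
  obtain ⟨n, hn⟩ := (hL.eventually hW).exists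
  exact ⟨m, n, hm.trans (hreach u (L.vert n) huW hn)⟩

theorem mem_endBoundary_mk_iff [G.LocallyFinite] :
    x ∈ endBoundary ℓ (Quotient.mk (raySetoid G) R) ↔ x ∈ boundary G ℓ ∧
      ∀ S : Set V, S.Finite → x ∈ closure (vertexPoint ℓ '' R.component S) := by
  refine and_congr_right fun hx => ⟨?_, fun hR => ?_⟩
  · rintro ⟨L, hL, hlim⟩ S hS
    have hRL : R.Equivalent L := Ray.equivalent_symm (Quotient.exact hL)
    exact mem_closure_of_tendsto hlim <|
      (hRL.eventually_vert_mem_component hS).mono fun _ => mem_image_of_mem _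
  · obtain ⟨L, hL⟩ := exists_ray_convergesTo hx
    exact ⟨L, Quotient.sound (Ray.equivalent_symm (equivalent_of_convergesTo hx hL hR)), hL⟩

theorem exists_mem_endBoundary [G.LocallyFinite] (hx : x ∈ boundary G ℓ) :
    ∃ ω : Ends G, x ∈ endBoundary ℓ ω := by
  obtain ⟨R, hR⟩ := exists_ray_convergesTo hx
  exact ⟨Quotient.mk _ R, hx, R, rfl, hR⟩

theorem subset_closure_image_component_of_isPreconnected {Y : Set (Completion G ℓ)}
    (hY : IsPreconnected Y) (hYb : Y ⊆ boundary G ℓ) (hxY : x ∈ Y) {S : Set V} (hS : S.Finite)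
    (hx : x ∈ closure (vertexPoint ℓ '' R.component S)) :
    Y ⊆ closure (vertexPoint ℓ '' R.component S) := by
  have hcover : Y ⊆ closure (vertexPoint ℓ '' R.component S) ∪
      closure (vertexPoint ℓ '' (R.component S)ᶜ) := fun y hy => by
    rw [← closure_union, ← image_union, union_compl_self, image_univ]
    exact mem_closure_range_vertexPoint (hYb hy)
  have hdisj : ∀ y ∈ Y, y ∈ closure (vertexPoint ℓ '' R.component S) →
      y ∉ closure (vertexPoint ℓ '' (R.component S)ᶜ) := by
    intro y hy hin hout
    obtain ⟨W, hW, hreach⟩ := exists_mem_nhds_reachableIn_compl (hYb hy) hS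
    obtain ⟨_, huW, u, hu, rfl⟩ := mem_closure_iff_nhds.1 hin W hW
    obtain ⟨_, hvW, v, hv, rfl⟩ := mem_closure_iff_nhds.1 hout W hW
    exact hv (Ray.mem_component_of_reachableIn hu (hreach u v huW hvW))
  exact (isPreconnected_iff_subset_of_disjoint_closed.1 hY _ _ isClosed_closure isClosed_closure
    hcover (eq_empty_of_forall_notMem fun y hy => hdisj y hy.1 hy.2.1 hy.2.2)).resolve_right
      fun h => hdisj x hxY hx (h hxY)

theorem subset_endBoundary_of_isPreconnected [G.LocallyFinite] {Y : Set (Completion G ℓ)}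
    (hY : IsPreconnected Y) (hYb : Y ⊆ boundary G ℓ) (hxY : x ∈ Y) (hx : x ∈ endBoundary ℓ ω) :
    Y ⊆ endBoundary ℓ ω := by
  obtain ⟨R, rfl⟩ := Quotient.exists_rep ω
  exact fun y hy => mem_endBoundary_mk_iff.2 ⟨hYb hy, fun S hS =>
    subset_closure_image_component_of_isPreconnected hY hYb hxY hS
      ((mem_endBoundary_mk_iff.1 hx).2 S hS) hy⟩

theorem coe_notMem_closure_subcomplex_component [G.LocallyFinite] (hℓ : ∀ e, 0 < ℓ e) (R : Ray G)
    (y : OneComplex G ℓ) : (y : Completion G ℓ) ∉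
      closure ((↑) '' subcomplex ℓ (R.component (cellVertices y))) := by
  obtain ⟨δ, hδ, hfar⟩ := exists_pos_forall_disjoint_le_edist hℓ y
  have hinducing := (Completion.isUniformInducing_coe (OneComplex G ℓ)).isInducing
  rw [← mem_preimage, ← hinducing.closure_eq_preimage_closure_image]
  intro hy
  obtain ⟨z, hzy, hz⟩ := mem_closure_iff_nhds.1 hy _ (Metric.eball_mem_nhds y hδ)
  exact (Metric.mem_eball'.1 hzy).not_ge <| hfar z <|
    (R.disjoint_component (cellVertices y)).symm.mono_right hz

theorem endBoundary_mk_eq_iInter [G.LocallyFinite] (hℓ : ∀ e, 0 < ℓ e) (R : Ray G) :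
    endBoundary ℓ (Quotient.mk (raySetoid G) R) =
      ⋂ S : Finset V, closure ((↑) '' subcomplex ℓ (R.component S)) := by
  refine Subset.antisymm (fun x hx => mem_iInter.2 fun S => ?_) fun x hx => ?_
  · refine closure_mono ?_ ((mem_endBoundary_mk_iff.1 hx).2 S S.finite_toSet)
    rintro _ ⟨v, hv, rfl⟩
    exact mem_image_of_mem _ (vertex_mem_subcomplex.2 hv)
  · have hmem : ∀ S : Set V, S.Finite → x ∈ closure ((↑) '' subcomplex ℓ (R.component S)) :=
      fun S hS => by simpa using mem_iInter.1 hx hS.toFinset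
    have hxb : x ∈ boundary G ℓ := by
      rintro ⟨y, rfl⟩
      exact coe_notMem_closure_subcomplex_component hℓ R y (hmem _ (finite_cellVertices y))
    exact mem_endBoundary_mk_iff.2
      ⟨hxb, fun S hS =>
        mem_closure_image_vertexPoint_of_mem_closure_subcomplex hxb (hmem S hS)⟩

theorem isConnected_endBoundary [G.LocallyFinite] (hℓ : ∀ e, 0 < ℓ e)
    [CompactSpace (Completion G ℓ)] (ω : Ends G) : IsConnected (endBoundary ℓ ω) := by
  classical
  obtain ⟨R, rfl⟩ := Quotient.exists_rep ω
  rw [endBoundary_mk_eq_iInter hℓ R]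
  refine isConnected_iInter_of_directed (fun S T => ⟨S ∪ T, ?_, ?_⟩) (fun S => ?_)
    fun S => isClosed_closure.isCompact
  · exact closure_mono <| image_mono <| subcomplex_mono <| R.component_anti <| by simp
  · exact closure_mono <| image_mono <| subcomplex_mono <| R.component_anti <| by simp
  · exact ((isPathConnected_subcomplex hℓ
      (R.connected_induce_component S.finite_toSet)).isConnected.image _
        (Completion.continuous_coe _).continuousOn).closure

theorem connectedComponentIn_boundary [G.LocallyFinite] (hℓ : ∀ e, 0 < ℓ e)
    [CompactSpace (Completion G ℓ)] (hx : x ∈ endBoundary ℓ ω) :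
    connectedComponentIn (boundary G ℓ) x = endBoundary ℓ ω :=
  Subset.antisymm
    (subset_endBoundary_of_isPreconnected isPreconnected_connectedComponentIn
      (connectedComponentIn_subset _ _) (mem_connectedComponentIn hx.1) hx)
    ((isConnected_endBoundary hℓ ω).isPreconnected.subset_connectedComponentIn hx
      fun _ hy => hy.1)

end EndBoundary

end LTop

theorem mainTheorem4 {V : Type*} (G : SimpleGraph V) [G.LocallyFinite] (ℓ : G.edgeSet → ℝ)
    (hℓ : ∀ e, 0 < ℓ e) (hcompact : CompactSpace (LTop.Completion G ℓ)) :
    (∀ ω : LTop.Ends G, IsConnected (LTop.endBoundary ℓ ω)) ∧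
      {C : Set (LTop.Completion G ℓ) | ∃ ω : LTop.Ends G, C = LTop.endBoundary ℓ ω} =
        {C : Set (LTop.Completion G ℓ) |
          ∃ x ∈ LTop.boundary G ℓ, C = connectedComponentIn (LTop.boundary G ℓ) x} := by
  refine ⟨LTop.isConnected_endBoundary hℓ, Set.Subset.antisymm ?_ ?_⟩
  · rintro C ⟨ω, rfl⟩
    obtain ⟨x, hx⟩ := (LTop.isConnected_endBoundary hℓ ω).nonempty
    exact ⟨x, hx.1, (LTop.connectedComponentIn_boundary hℓ hx).symm⟩
  · rintro C ⟨x, hx, rfl⟩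
    obtain ⟨ω, hω⟩ := LTop.exists_mem_endBoundary hx
    exact ⟨ω, LTop.connectedComponentIn_boundary hℓ hω⟩
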